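/- Let $E\neq 0$ be a uniformly convex Banach space over $\mathbb K=\mathbb R$ or $\mathbb C$ and let $\rho$ be a unitary representation of the free group $F_2$ of rank two on $E$, that is, a homomorphism from $F_2$ to the group of norm-preserving $\mathbb K$-linear automorphisms of $E$. A function $F:F_2\to E$ is a cocycle if $F(gg')=F(g)+\rho(g)F(g')$ for all $g,g'\in F_2$, and a quasi-cocycle if $\sup_{g,g'\in F_2}\|F(gg')-F(g)-\rho(g)F(g')\|<\infty$. Let $QC(F_2;\rho)$ be the vector space of quasi-cocycles, and let $\widetilde{QC}(F_2;\rho)$ be its quotient by the subspace generated by the bounded functions $F_2\to E$ and the cocycles. Then $$\dim_{\mathbb K}\widetilde{QC}(F_2;\rho)=\infty .$$ Equivalently, the kernel of the comparison map $H^2_b(F_2;\rho)\to H^2(F_2;\rho)$ from the second bounded cohomology to the second group cohomology of $F_2$ with coefficients in $\rho$ is infinite dimensional over $\mathbb K$. -/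

import Mathlib

namespace QuasiCocycle

section Defs

variable {𝕜 : Type*} [RCLike 𝕜] {G : Type*} [Group G]
  {E : Type*} [NormedAddCommGroup E] [NormedSpace 𝕜 E]

variable (𝕜) in
/-- The space of norm-bounded functions `X → E`. -/
def boundedFunctions (X E : Type*) [NormedAddCommGroup E] [NormedSpace 𝕜 E] :
    Submodule 𝕜 (X → E) where
  carrier := {F | ∃ C : ℝ, ∀ x, ‖F x‖ ≤ C}
  zero_mem' := ⟨0, fun x => by simp⟩
  add_mem' := by
    rintro F F' ⟨C, hC⟩ ⟨C', hC'⟩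
    exact ⟨C + C', fun x => norm_add_le_of_le (hC x) (hC' x)⟩
  smul_mem' := by
    rintro c F ⟨C, hC⟩
    refine ⟨‖c‖ * C, fun x => ?_⟩
    rw [Pi.smul_apply, norm_smul]
    exact mul_le_mul_of_nonneg_left (hC x) (norm_nonneg c)

/-- Cocycles for `ρ`: functions with `F (g g') = F g + ρ g (F g')`. -/
def cocycles (ρ : G →* (E ≃ₗᵢ[𝕜] E)) : Submodule 𝕜 (G → E) where
  carrier := {F | ∀ g g', F (g * g') = F g + ρ g (F g')}
  zero_mem' := fun g g' => by simp
  add_mem' := by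
    intro F F' h h' g g'
    simp only [Pi.add_apply, h g g', h' g g', map_add]
    abel
  smul_mem' := by
    intro c F h g g'
    simp only [Pi.smul_apply, h g g', map_smul, smul_add]

/-- Quasi-cocycles for `ρ`: functions whose defect
`sup ‖F (g g') - F g - ρ g (F g')‖` is finite. -/
def quasiCocycles (ρ : G →* (E ≃ₗᵢ[𝕜] E)) : Submodule 𝕜 (G → E) where
  carrier := {F | ∃ C : ℝ, ∀ g g', ‖F (g * g') - F g - ρ g (F g')‖ ≤ C}
  zero_mem' := ⟨0, fun g g' => by simp⟩
  add_mem' := by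
    rintro F F' ⟨C, hC⟩ ⟨C', hC'⟩
    refine ⟨C + C', fun g g' => ?_⟩
    have h : (F + F') (g * g') - (F + F') g - ρ g ((F + F') g') =
        (F (g * g') - F g - ρ g (F g')) + (F' (g * g') - F' g - ρ g (F' g')) := by
      simp only [Pi.add_apply, map_add]
      abel
    rw [h]
    exact norm_add_le_of_le (hC g g') (hC' g g')
  smul_mem' := by
    rintro c F ⟨C, hC⟩
    refine ⟨‖c‖ * C, fun g g' => ?_⟩
    have h : (c • F) (g * g') - (c • F) g - ρ g ((c • F) g') =
        c • (F (g * g') - F g - ρ g (F g')) := by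
      simp only [Pi.smul_apply, map_smul, smul_sub]
    rw [h, norm_smul]
    exact mul_le_mul_of_nonneg_left (hC g g') (norm_nonneg c)

theorem boundedFunctions_sup_cocycles_le (ρ : G →* (E ≃ₗᵢ[𝕜] E)) :
    boundedFunctions 𝕜 G E ⊔ cocycles ρ ≤ quasiCocycles ρ := by
  refine sup_le ?_ ?_
  · rintro F ⟨C, hC⟩
    refine ⟨C + C + C, fun g g' => ?_⟩
    refine (norm_sub_le_of_le (norm_sub_le_of_le (hC _) (hC _)) ?_)
    rw [LinearIsometryEquiv.norm_map]
    exact hC g'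
  · intro F hF
    exact ⟨0, fun g g' => by rw [hF g g']; simp⟩

/-- The space of essential quasi-cocycles: quasi-cocycles modulo the subspace generated by the
bounded functions and the cocycles. -/
abbrev EssentialQuasiCocycles (ρ : G →* (E ≃ₗᵢ[𝕜] E)) : Type _ :=
  quasiCocycles ρ ⧸ (boundedFunctions 𝕜 G E ⊔ cocycles ρ).submoduleOf (quasiCocycles ρ)

/-- The coboundary from 1-cochains to 2-cochains in the inhomogeneous complex with coefficients
in `ρ`. -/
def coboundary₁ (ρ : G →* (E ≃ₗᵢ[𝕜] E)) : (G → E) →ₗ[𝕜] (G × G → E) where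
  toFun F := fun p => ρ p.1 (F p.2) - F (p.1 * p.2) + F p.1
  map_add' F F' := by
    funext p
    simp only [Pi.add_apply, map_add]
    abel
  map_smul' c F := by
    funext p
    simp only [Pi.smul_apply, map_smul, smul_sub, smul_add, RingHom.id_apply]

/-- The coboundary from 2-cochains to 3-cochains in the inhomogeneous complex with coefficients
in `ρ`. -/
def coboundary₂ (ρ : G →* (E ≃ₗᵢ[𝕜] E)) : (G × G → E) →ₗ[𝕜] (G × G × G → E) where
  toFun c := fun p =>
    ρ p.1 (c (p.2.1, p.2.2)) - c (p.1 * p.2.1, p.2.2) + c (p.1, p.2.1 * p.2.2) - c (p.1, p.2.1)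
  map_add' c c' := by
    funext p
    simp only [Pi.add_apply, map_add]
    abel
  map_smul' r c := by
    funext p
    simp only [Pi.smul_apply, map_smul, smul_sub, smul_add, RingHom.id_apply]

theorem coboundary₂_coboundary₁ (ρ : G →* (E ≃ₗᵢ[𝕜] E)) (F : G → E) :
    coboundary₂ ρ (coboundary₁ ρ F) = 0 := by
  funext p
  simp only [coboundary₁, coboundary₂, LinearMap.coe_mk, AddHom.coe_mk, map_mul, map_sub, map_add,
    LinearIsometryEquiv.coe_mul, Function.comp_apply, mul_assoc, Pi.zero_apply]
  abel

theorem coboundary₁_bounded (ρ : G →* (E ≃ₗᵢ[𝕜] E)) {F : G → E}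
    (hF : F ∈ boundedFunctions 𝕜 G E) :
    coboundary₁ ρ F ∈ boundedFunctions 𝕜 (G × G) E := by
  obtain ⟨C, hC⟩ := hF
  refine ⟨C + C + C, fun p => norm_add_le_of_le (norm_sub_le_of_le ?_ (hC _)) (hC _)⟩
  rw [LinearIsometryEquiv.norm_map]
  exact hC p.2

/-- The 2-cocycles. -/
def Z2 (ρ : G →* (E ≃ₗᵢ[𝕜] E)) : Submodule 𝕜 (G × G → E) := LinearMap.ker (coboundary₂ ρ)

/-- The 2-coboundaries. -/
def B2 (ρ : G →* (E ≃ₗᵢ[𝕜] E)) : Submodule 𝕜 (G × G → E) := LinearMap.range (coboundary₁ ρ)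

/-- The bounded 2-cocycles. -/
def Z2b (ρ : G →* (E ≃ₗᵢ[𝕜] E)) : Submodule 𝕜 (G × G → E) :=
  Z2 ρ ⊓ boundedFunctions 𝕜 (G × G) E

/-- The coboundaries of bounded 1-cochains. -/
def B2b (ρ : G →* (E ≃ₗᵢ[𝕜] E)) : Submodule 𝕜 (G × G → E) :=
  (boundedFunctions 𝕜 G E).map (coboundary₁ ρ)

theorem B2_le_Z2 (ρ : G →* (E ≃ₗᵢ[𝕜] E)) : B2 ρ ≤ Z2 ρ := by
  rintro _ ⟨F, rfl⟩
  exact coboundary₂_coboundary₁ ρ F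

theorem B2b_le_Z2b (ρ : G →* (E ≃ₗᵢ[𝕜] E)) : B2b ρ ≤ Z2b ρ := by
  rintro _ ⟨F, hF, rfl⟩
  exact ⟨coboundary₂_coboundary₁ ρ F, coboundary₁_bounded ρ hF⟩

/-- The second group cohomology with coefficients in `ρ`. -/
abbrev H2 (ρ : G →* (E ≃ₗᵢ[𝕜] E)) : Type _ := Z2 ρ ⧸ (B2 ρ).submoduleOf (Z2 ρ)

/-- The second bounded cohomology with coefficients in `ρ`. -/
abbrev H2b (ρ : G →* (E ≃ₗᵢ[𝕜] E)) : Type _ := Z2b ρ ⧸ (B2b ρ).submoduleOf (Z2b ρ)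

/-- The comparison map from bounded cohomology to cohomology in degree two, induced by the
inclusion of the bounded 2-cocycles in the 2-cocycles. -/
def comparison (ρ : G →* (E ≃ₗᵢ[𝕜] E)) : H2b ρ →ₗ[𝕜] H2 ρ :=
  Submodule.mapQ _ _ (Submodule.inclusion (inf_le_left : Z2b ρ ≤ Z2 ρ)) (by
    rintro x ⟨F, _, hF⟩
    exact ⟨F, hF⟩)

end Defs

end QuasiCocycle

/-! Write `F_2` as a free product of two infinite cyclic groups. A bounded map `lam` on the
syllables, odd under inversion up to `ρ`, is summed along normal forms. Cancelling syllables
contribute nothing and at most one pair merges, so the sum is a quasi-cocycle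
(`syllableSum_prod_smul`).

Suppose it is `B + C` with `B` bounded and `C` a cocycle, and `lam` vanishes on the second factor.
Fix `b ≠ 1` there. Left multiplication by `a b` acts on the values of `B` at words not starting in
the second factor by an affine isometry. Uniform convexity gives all these isometries a common fixed
point `c`, the Chebyshev centre. Adding the coboundary of `c` to `C` gives a cocycle with value `lam
a` at every `a b` with `a ≠ 1`. If `lam` has finite support, the cocycle identity then forces `lam =
0` (`eq_zero_of_syllableCochain_mem`). Finitely supported maps give infinitely many dimensions. -/

section ChebyshevCenter

/-! ### Chebyshev centres in uniformly convex spaces. -/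

variable {E : Type*} [NormedAddCommGroup E] [NormedSpace ℝ E] [UniformConvexSpace E]

/-- In a uniformly convex space, if no ball of radius less than `R` contains `O`, then the
centres of two balls containing `O` whose radii are close to `R` are close to each other. -/
theorem UniformConvexSpace.exists_pos_forall_center_norm_sub_lt {O : Set E} (hO : O.Nonempty)
    {R : ℝ} (hR0 : 0 ≤ R) (hR : ∀ r x, (∀ o ∈ O, ‖x - o‖ ≤ r) → R ≤ r) {ε : ℝ} (hε : 0 < ε) :
    ∃ η, 0 < η ∧ ∀ x y, (∀ o ∈ O, ‖x - o‖ ≤ R + η) → (∀ o ∈ O, ‖y - o‖ ≤ R + η) →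
      ‖x - y‖ < ε := by
  rcases hR0.eq_or_lt with rfl | hRpos
  · obtain ⟨o, ho⟩ := hO
    refine ⟨ε / 3, by positivity, fun x y hx hy => ?_⟩
    have h := norm_sub_le_of_le (hx o ho) (hy o ho)
    rw [sub_sub_sub_cancel_right] at h
    linarith
  · obtain ⟨δ, hδ, H⟩ := exists_forall_closed_ball_dist_add_le_two_sub E
      (show 0 < ε / (R + 1) by positivity)
    -- The bound `1` keeps the rescaled centres `ε / (R + 1)` apart. The bound `δ * R / 4` makes `(R
    -- + η) * (1 - δ / 2) < R`, so the midpoint would beat the optimal radius.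
    refine ⟨min 1 (δ * R / 4), by positivity, fun x y hx hy => ?_⟩
    set η := min 1 (δ * R / 4) with hη
    have hη0 : 0 < η := by positivity
    have hη1 : η ≤ 1 := min_le_left _ _
    have hη2 : η ≤ δ * R / 4 := min_le_right _ _
    by_contra! hxy
    have hr : 0 < R + η := by positivity
    have hn : ∀ z : E, ‖(R + η)⁻¹ • z‖ = ‖z‖ / (R + η) := fun z => by
      rw [norm_smul_of_nonneg (by positivity), div_eq_inv_mul]
    have hmid : ∀ o ∈ O, ‖(2⁻¹ : ℝ) • (x + y) - o‖ ≤ (R + η) * (1 - δ / 2) := by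
      intro o ho
      have h := @H ((R + η)⁻¹ • (x - o)) (by rw [hn, div_le_one hr]; exact hx o ho)
        ((R + η)⁻¹ • (y - o)) (by rw [hn, div_le_one hr]; exact hy o ho) (by
          rw [← smul_sub, sub_sub_sub_cancel_right, hn]
          gcongr)
      rw [← smul_add, hn, div_le_iff₀ hr] at h
      have hmidpoint : (2⁻¹ : ℝ) • (x + y) - o = (2⁻¹ : ℝ) • (x - o + (y - o)) := by module
      rw [hmidpoint, norm_smul_of_nonneg (by norm_num)]
      linarith
    have := hR _ _ hmid
    nlinarith

/-- A nonempty bounded subset of a complete uniformly convex space has a Chebyshev centre, and it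
is fixed by every surjective isometry mapping the set into itself. -/
theorem UniformConvexSpace.exists_forall_isometry_fixed [CompleteSpace E] {O : Set E}
    (hO : O.Nonempty) {K : ℝ} (hK : ∀ o ∈ O, ‖o‖ ≤ K) :
    ∃ c : E, ∀ T : E ≃ᵢ E, Set.MapsTo T O O → T c = c := by
  set A : Set ℝ := {r | ∃ x : E, ∀ o ∈ O, ‖x - o‖ ≤ r} with hA
  have hA0 : ∀ r ∈ A, 0 ≤ r := by
    rintro r ⟨x, hx⟩
    obtain ⟨o, ho⟩ := hO
    exact (norm_nonneg _).trans (hx o ho)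
  have hAne : A.Nonempty := ⟨K, 0, fun o ho => by simpa using hK o ho⟩
  have hR0 : 0 ≤ sInf A := Real.sInf_nonneg hA0
  have hR : ∀ r x, (∀ o ∈ O, ‖x - o‖ ≤ r) → sInf A ≤ r := fun r x hx =>
    csInf_le ⟨0, hA0⟩ ⟨x, hx⟩
  have hclose := fun ε (hε : 0 < ε) =>
    UniformConvexSpace.exists_pos_forall_center_norm_sub_lt hO hR0 hR hε
  have hex : ∀ n : ℕ, ∃ x : E, ∀ o ∈ O, ‖x - o‖ ≤ sInf A + 1 / ((n : ℝ) + 1) := by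
    intro n
    obtain ⟨r, ⟨x, hx⟩, hr⟩ := exists_lt_of_csInf_lt hAne
      (lt_add_of_pos_right (sInf A) (Nat.one_div_pos_of_nat (α := ℝ) (n := n)))
    exact ⟨x, fun o ho => (hx o ho).trans hr.le⟩
  choose x hx using hex
  have hcauchy : CauchySeq x := by
    rw [Metric.cauchySeq_iff]
    intro ε hε
    obtain ⟨η, hη, h⟩ := hclose ε hε
    obtain ⟨N, hN⟩ := exists_nat_one_div_lt hη
    have hxη : ∀ n ≥ N, ∀ o ∈ O, ‖x n - o‖ ≤ sInf A + η := fun n hn o ho => by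
      have h1 := hx n o ho
      have h2 := Nat.one_div_le_one_div (α := ℝ) hn
      linarith
    exact ⟨N, fun m hm n hn => by rw [dist_eq_norm]; exact h _ _ (hxη m hm) (hxη n hn)⟩
  obtain ⟨c, hc⟩ := cauchySeq_tendsto_of_complete hcauchy
  have hcO : ∀ o ∈ O, ‖c - o‖ ≤ sInf A := by
    intro o ho
    have hlim := (tendsto_one_div_add_atTop_nhds_zero_nat (𝕜 := ℝ)).const_add (sInf A)
    rw [add_zero] at hlim
    exact le_of_tendsto_of_tendsto' (hc.sub_const o).norm hlim fun n => hx n o ho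
  refine ⟨c, fun T hT => ?_⟩
  -- The preimage of a centre is again a centre; for this, `T` need only map `O` into itself, not
  -- onto it.
  have hTc : ∀ o ∈ O, ‖T.symm c - o‖ ≤ sInf A := by
    intro o ho
    have h : dist (T.symm c) o = dist c (T o) := by
      rw [← T.dist_eq, T.apply_symm_apply]
    rw [← dist_eq_norm, h, dist_eq_norm]
    exact hcO _ (hT ho)
  have heq : T.symm c = c := by
    by_contra hne
    obtain ⟨η, hη, h⟩ := hclose _ (norm_pos_iff.2 (sub_ne_zero.2 hne))
    exact (h _ _ (fun o ho => (hTc o ho).trans (by linarith))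
      fun o ho => (hcO o ho).trans (by linarith)).false
  rw [← T.eq_symm_apply]
  exact heq.symm

end ChebyshevCenter

namespace QuasiCocycle

open Monoid.CoprodI

/-! ### Quasi-cocycles from sums over syllables. -/

section SyllableSum

variable {𝕜 : Type*} [RCLike 𝕜] {ι : Type*} {G : ι → Type*} [∀ i, Group (G i)]
  {E : Type*} [NormedAddCommGroup E] [NormedSpace 𝕜 E]

/-- The sum over the syllables `s` of a reduced word of the translates of `lam s` by the prefix of
the word preceding `s`. -/
def syllableSum (ρ : Monoid.CoprodI G →* (E ≃ₗᵢ[𝕜] E)) (lam : ∀ i, G i → E) (w : Word G) : E :=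
  w.toList.foldr (fun s v => lam s.1 s.2 + ρ (of s.2) v) 0

variable (ρ : Monoid.CoprodI G →* (E ≃ₗᵢ[𝕜] E)) (lam : ∀ i, G i → E)

theorem syllableSum_empty : syllableSum ρ lam Word.empty = 0 := rfl

theorem syllableSum_cons {i : ι} (s : G i) (w : Word G) (h₁ : w.fstIdx ≠ some i) (h₂ : s ≠ 1) :
    syllableSum ρ lam (Word.cons s w h₁ h₂) = lam i s + ρ (of s) (syllableSum ρ lam w) := rfl

theorem syllableSum_add (lam' : ∀ i, G i → E) (w : Word G) :
    syllableSum ρ (lam + lam') w = syllableSum ρ lam w + syllableSum ρ lam' w := by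
  induction w using Word.consRecOn with
  | empty => simp [syllableSum_empty]
  | cons i s w h₁ h₂ ih =>
    simp only [syllableSum_cons, ih, Pi.add_apply, map_add]
    abel

theorem syllableSum_smul (c : 𝕜) (w : Word G) :
    syllableSum ρ (c • lam) w = c • syllableSum ρ lam w := by
  induction w using Word.consRecOn with
  | empty => simp [syllableSum_empty]
  | cons i s w h₁ h₂ ih =>
    simp only [syllableSum_cons, ih, Pi.smul_apply, map_smul, smul_add]

/-- A family of maps on the factors of a free product is alternating if
`lam s⁻¹ = -ρ(s⁻¹) (lam s)` for every `s`. -/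
def IsAlternating : Prop :=
  ∀ i (s : G i), lam i s⁻¹ = -ρ (of s⁻¹) (lam i s)

variable {ρ lam}

theorem IsAlternating.map_one (h : IsAlternating ρ lam) (i : ι) : lam i 1 = 0 := by
  have h1 := h i 1
  rw [inv_one, _root_.map_one, _root_.map_one, LinearIsometryEquiv.coe_one, id,
    eq_neg_iff_add_eq_zero, ← two_smul 𝕜] at h1
  exact (smul_eq_zero.1 h1).resolve_left two_ne_zero

theorem syllableSum_rcons [∀ i, DecidableEq (G i)] (h : IsAlternating ρ lam) {i : ι}
    (p : Word.Pair G i) :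
    syllableSum ρ lam (Word.rcons p) =
      lam i p.head + ρ (of p.head) (syllableSum ρ lam p.tail) := by
  by_cases hp : p.head = 1
  · simp [Word.rcons, hp, h.map_one]
  · rw [Word.rcons, dif_neg hp, syllableSum_cons]

variable [DecidableEq ι] [∀ i, DecidableEq (G i)]

theorem syllableSum_of_smul (h : IsAlternating ρ lam) {i : ι} (s : G i) (w : Word G) :
    syllableSum ρ lam (of s • w) = lam i (s * (Word.equivPair i w).head) +
      ρ (of (s * (Word.equivPair i w).head)) (syllableSum ρ lam (Word.equivPair i w).tail) := by
  rw [Word.of_smul_def, syllableSum_rcons h]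

theorem syllableSum_equivPair (h : IsAlternating ρ lam) (i : ι) (w : Word G) :
    syllableSum ρ lam w = lam i (Word.equivPair i w).head +
      ρ (of (Word.equivPair i w).head) (syllableSum ρ lam (Word.equivPair i w).tail) := by
  simpa using syllableSum_of_smul h (1 : G i) w

/-- Multiplying by one syllable disturbs only the leading syllable of `w` in the same factor; the
tail contributions agree. -/
theorem syllableSum_of_smul_sub (h : IsAlternating ρ lam) {i : ι} (s : G i) (w : Word G) :
    syllableSum ρ lam (of s • w) - (lam i s + ρ (of s) (syllableSum ρ lam w)) =
      lam i (s * (Word.equivPair i w).head) -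
        (lam i s + ρ (of s) (lam i (Word.equivPair i w).head)) := by
  rw [syllableSum_of_smul h, syllableSum_equivPair h i w]
  simp only [map_add, map_mul, LinearIsometryEquiv.coe_mul, Function.comp_apply]
  abel

theorem syllableSum_of_smul_of_fstIdx_ne (h : IsAlternating ρ lam) {i : ι} (s : G i) {w : Word G}
    (hw : w.fstIdx ≠ some i) :
    syllableSum ρ lam (of s • w) = lam i s + ρ (of s) (syllableSum ρ lam w) := by
  rw [← sub_eq_zero, syllableSum_of_smul_sub h, Word.equivPair_eq_of_fstIdx_ne hw]
  simp [h.map_one]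

theorem fstIdx_of_smul {i : ι} {s : G i} {w : Word G} (hs : s * (Word.equivPair i w).head ≠ 1) :
    (of s • w).fstIdx = some i := by
  rw [Word.of_smul_def, Word.rcons, dif_neg hs, Word.fstIdx_cons]

theorem fstIdx_of_smul_of_fstIdx_ne {i : ι} {s : G i} {w : Word G} (hs : s ≠ 1)
    (hw : w.fstIdx ≠ some i) : (of s • w).fstIdx = some i :=
  fstIdx_of_smul (by simpa [Word.equivPair_eq_of_fstIdx_ne hw] using hs)

/-- At most one pair of syllables in a product of two reduced words merges without cancelling,
which accounts for the whole defect of `syllableSum`. -/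
theorem syllableSum_prod_smul (h : IsAlternating ρ lam) {K : ℝ} (hK : ∀ i s, ‖lam i s‖ ≤ K)
    (u w : Word G) :
    syllableSum ρ lam (u.prod • w) =
        syllableSum ρ lam u + ρ u.prod (syllableSum ρ lam w) ∨
      (u.prod • w).fstIdx = u.fstIdx ∧
        ‖syllableSum ρ lam (u.prod • w) -
          (syllableSum ρ lam u + ρ u.prod (syllableSum ρ lam w))‖ ≤ K + (K + K) := by
  induction u using Word.consRecOn with
  | empty => left; simp [syllableSum_empty]
  | cons i s u h₁ h₂ ih =>
    set w' := u.prod • w with hw'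
    have hsplit : syllableSum ρ lam (of s • w') -
        (lam i s + ρ (of s) (syllableSum ρ lam u) +
          ρ (of s) (ρ u.prod (syllableSum ρ lam w))) =
        (syllableSum ρ lam (of s • w') - (lam i s + ρ (of s) (syllableSum ρ lam w'))) +
        ρ (of s) (syllableSum ρ lam w' -
          (syllableSum ρ lam u + ρ u.prod (syllableSum ρ lam w))) := by
      simp only [map_sub, map_add]
      abel
    simp only [Word.prod_cons, mul_smul, ← hw', syllableSum_cons, Word.fstIdx_cons, map_mul,
      LinearIsometryEquiv.coe_mul, Function.comp_apply]
    rw [← sub_eq_zero (a := syllableSum ρ lam (of s • w')), hsplit]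
    rcases ih with ih | ⟨hfst, ih⟩
    · rw [← sub_eq_zero] at ih
      rw [ih, map_zero, add_zero, syllableSum_of_smul_sub h]
      by_cases hs : s * (Word.equivPair i w').head = 1
      -- The syllables cancel, and alternation says exactly that `lam i s + ρ(s) (lam i s⁻¹) = 0`.
      · left
        rw [hs, h.map_one, ← inv_eq_of_mul_eq_one_right hs, h i s, map_neg,
          ← Function.comp_apply (f := ρ (of s)), ← LinearIsometryEquiv.coe_mul, ← map_mul,
          ← map_mul]
        simp
      · right
        refine ⟨fstIdx_of_smul hs, norm_sub_le_of_le (hK _ _) (norm_add_le_of_le (hK _ _) ?_)⟩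
        rw [LinearIsometryEquiv.norm_map]
        exact hK _ _
    -- After a merge the product still starts in the same factor as `u`, so reducedness of the word
    -- excludes any further interaction and the defect is only translated.
    · right
      rw [← hfst] at h₁
      refine ⟨fstIdx_of_smul_of_fstIdx_ne h₂ h₁, ?_⟩
      rw [syllableSum_of_smul_of_fstIdx_ne h s h₁, sub_self, zero_add,
        LinearIsometryEquiv.norm_map]
      exact ih

variable (ρ lam) in
/-- The function on a free product summing the translates of `lam` over the syllables of the
normal form of an element. -/
def syllableCochain (g : Monoid.CoprodI G) : E := syllableSum ρ lam (g • Word.empty)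

theorem syllableCochain_mul (g g' : Monoid.CoprodI G) :
    syllableCochain ρ lam (g * g') = syllableSum ρ lam (g • g' • Word.empty) :=
  congrArg (syllableSum ρ lam) (mul_smul g g' (Word.empty : Word G))

theorem syllableCochain_mem_quasiCocycles (h : IsAlternating ρ lam) {K : ℝ}
    (hK : ∀ i s, ‖lam i s‖ ≤ K) : syllableCochain ρ lam ∈ quasiCocycles ρ := by
  -- If `ι` is empty, `hK` does not force `K` to be nonnegative.
  refine ⟨|K + (K + K)|, fun g g' => ?_⟩
  have hg : (g • (Word.empty : Word G)).prod = g := by simp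
  have hd := syllableSum_prod_smul h hK (g • Word.empty) (g' • Word.empty)
  rw [hg, ← syllableCochain_mul] at hd
  change _ = syllableCochain ρ lam g + ρ g (syllableCochain ρ lam g') ∨ _ ∧
    ‖_ - (syllableCochain ρ lam g + ρ g (syllableCochain ρ lam g'))‖ ≤ _ at hd
  rw [sub_sub]
  rcases hd with hd | ⟨-, hd⟩
  · rw [hd, sub_self, norm_zero]
    exact abs_nonneg _
  · exact hd.trans (le_abs_self _)

end SyllableSum

end QuasiCocycle

namespace QuasiCocycle

open Monoid.CoprodI

/-! ### Triviality forces the syllable map to vanish. -/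

section Rigidity

variable {𝕜 : Type*} [RCLike 𝕜] {ι : Type*} {G : ι → Type*} [∀ i, Group (G i)]
  {E : Type*} [NormedAddCommGroup E] [NormedSpace 𝕜 E]
  [DecidableEq ι] [∀ i, DecidableEq (G i)]
  {ρ : Monoid.CoprodI G →* (E ≃ₗᵢ[𝕜] E)} {lam : ∀ i, G i → E}

theorem syllableCochain_of_mul_of_mul (h : IsAlternating ρ lam) {i j : ι} (hij : i ≠ j)
    (hlam : lam j = 0) (a : G i) {b : G j} (hb : b ≠ 1) {g : Monoid.CoprodI G}
    (hg : (g • (Word.empty : Word G)).fstIdx ≠ some j) :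
    syllableCochain ρ lam (of a * of b * g) =
      lam i a + ρ (of a * of b) (syllableCochain ρ lam g) := by
  have hbg : (of b • g • (Word.empty : Word G)).fstIdx ≠ some i := by
    rw [fstIdx_of_smul_of_fstIdx_ne hb hg]
    simpa using hij.symm
  rw [syllableCochain_mul, mul_smul, syllableSum_of_smul_of_fstIdx_ne h a hbg,
    syllableSum_of_smul_of_fstIdx_ne h b hg, hlam, Pi.zero_apply, zero_add, map_mul,
    LinearIsometryEquiv.coe_mul, Function.comp_apply, syllableCochain]

theorem fstIdx_of_mul_of_mul {i j : ι} (hij : i ≠ j) {a : G i} (ha : a ≠ 1) {b : G j}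
    (hb : b ≠ 1) {g : Monoid.CoprodI G} (hg : (g • (Word.empty : Word G)).fstIdx ≠ some j) :
    ((of a * of b * g) • (Word.empty : Word G)).fstIdx = some i := by
  have hbg : (of b • g • (Word.empty : Word G)).fstIdx ≠ some i := by
    rw [fstIdx_of_smul_of_fstIdx_ne hb hg]
    simpa using hij.symm
  rw [mul_smul, mul_smul, fstIdx_of_smul_of_fstIdx_ne ha hbg]

/-- If `syllableCochain ρ lam` is at bounded distance from a cocycle, then it agrees with a cocycle
on all the products `a b` with `a ≠ 1` in one factor and a fixed `b ≠ 1` in another one. -/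
theorem exists_cocycle_of_syllableCochain_mem [CompleteSpace E] [UniformConvexSpace E]
    (h : IsAlternating ρ lam) {i j : ι} (hij : i ≠ j) (hlam : lam j = 0) {b : G j} (hb : b ≠ 1)
    (hF : syllableCochain ρ lam ∈ boundedFunctions 𝕜 (Monoid.CoprodI G) E ⊔ cocycles ρ) :
    ∃ C ∈ cocycles ρ, ∀ a : G i, a ≠ 1 → C (of a * of b) = lam i a := by
  let _ : NormedSpace ℝ E := NormedSpace.restrictScalars ℝ 𝕜 E
  obtain ⟨B, ⟨K, hK⟩, C, hC, hBC⟩ := Submodule.mem_sup.1 hF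
  -- On `S`, left multiplication by `a b` with `a ≠ 1` causes no cancellation or merging, and it
  -- maps `S` into itself.
  set S : Set (Monoid.CoprodI G) := {g | (g • (Word.empty : Word G)).fstIdx ≠ some j} with hS
  have h1S : (1 : Monoid.CoprodI G) ∈ S := by
    have : (1 : Monoid.CoprodI G) • (Word.empty : Word G) = Word.empty := one_smul _ _
    simp [hS, this, Word.fstIdx]
  have hB : ∀ g, B g = syllableCochain ρ lam g - C g := fun g => by
    rw [← hBC, Pi.add_apply, add_sub_cancel_right]
  have hF1 : syllableCochain ρ lam 1 = 0 := by
    have : (1 : Monoid.CoprodI G) • (Word.empty : Word G) = Word.empty := one_smul _ _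
    rw [syllableCochain, this, syllableSum_empty]
  have hFab : ∀ a : G i, syllableCochain ρ lam (of a * of b) = lam i a := fun a => by
    simpa [hF1] using syllableCochain_of_mul_of_mul h hij hlam a hb h1S
  have hBmul : ∀ (a : G i), ∀ g ∈ S,
      B (of a * of b * g) = B (of a * of b) + ρ (of a * of b) (B g) := by
    intro a g hg
    rw [hB, hB, hB, syllableCochain_of_mul_of_mul h hij hlam a hb hg, hFab, hC, map_sub]
    abel
  obtain ⟨c, hc⟩ := UniformConvexSpace.exists_forall_isometry_fixed (O := B '' S)
    ⟨_, 1, h1S, rfl⟩ (K := K) (by rintro _ ⟨g, -, rfl⟩; exact hK g)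
  refine ⟨fun g => C g + (c - ρ g c), fun g g' => ?_, fun a ha => ?_⟩
  · simp only [hC g g', map_add, map_sub, map_mul, LinearIsometryEquiv.coe_mul,
      Function.comp_apply]
    abel
  · have hfix := hc ((ρ (of a * of b)).toIsometryEquiv.trans
      (IsometryEquiv.addLeft (B (of a * of b)))) (by
        rintro _ ⟨g, hg, rfl⟩
        refine ⟨of a * of b * g, ?_, hBmul a g hg⟩
        rw [hS, Set.mem_ofPred_eq, fstIdx_of_mul_of_mul hij ha hb hg]
        simpa using hij)
    change B (of a * of b) + ρ (of a * of b) c = c at hfix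
    rw [hB, hFab] at hfix
    rw [← sub_eq_zero]
    have : C (of a * of b) + (c - ρ (of a * of b) c) - lam i a =
      c - (lam i a - C (of a * of b) + ρ (of a * of b) c) := by abel
    simpa only [this, sub_eq_zero] using hfix.symm

/-- A syllable cochain supported on finitely many elements of an infinite factor is at bounded
distance from a cocycle only if it vanishes. -/
theorem eq_zero_of_syllableCochain_mem [CompleteSpace E] [UniformConvexSpace E]
    (h : IsAlternating ρ lam) {i j : ι} (hij : i ≠ j) (hlam : lam j = 0) [Infinite (G i)]
    [Nontrivial (G j)] (hfin : (Function.support (lam i)).Finite)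
    (hF : syllableCochain ρ lam ∈ boundedFunctions 𝕜 (Monoid.CoprodI G) E ⊔ cocycles ρ) :
    lam i = 0 := by
  obtain ⟨b, hb⟩ := exists_ne (1 : G j)
  obtain ⟨C, hC, hCab⟩ := exists_cocycle_of_syllableCochain_mem h hij hlam hb hF
  -- Evaluate the cocycle at `a a' b` in two ways.
  have hmul : ∀ a a' : G i, a' ≠ 1 → a * a' ≠ 1 →
      lam i (a * a') = C (of a) + ρ (of a) (lam i a') :=
    fun a a' ha' haa' => by
      rw [← hCab _ haa', ← hCab _ ha', ← hC, map_mul, mul_assoc]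
  set Z : Set (G i) := insert 1 (Function.support (lam i)) with hZ
  have hZfin : Z.Finite := hfin.insert 1
  have hnotin : ∀ a ∉ Z, a ≠ 1 ∧ lam i a = 0 := fun a ha => by
    simpa [hZ, not_or] using ha
  have hCa : ∀ a : G i, C (of a) = 0 := by
    intro a
    -- With `a'` and `a * a'` both off the support, `hmul` leaves only `C (of a)`.
    obtain ⟨a', ha'⟩ := (hZfin.union
      (hZfin.preimage (mul_right_injective a).injOn)).exists_notMem
    rw [Set.mem_union, not_or] at ha'
    obtain ⟨h1, h2⟩ := hnotin _ ha'.1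
    obtain ⟨h3, h4⟩ := hnotin _ ha'.2
    simpa [h2, h4] using (hmul a a' h1 h3).symm
  funext a'
  by_cases ha' : a' = 1
  · rw [ha', h.map_one, Pi.zero_apply]
  -- Now `a` moves `a'` off the support, and `hmul` reduces to `ρ(a) (lam i a') = 0`.
  obtain ⟨a, ha⟩ := (hZfin.preimage (mul_left_injective a').injOn).exists_notMem
  obtain ⟨h1, h2⟩ := hnotin _ ha
  simpa [h2, hCa] using (hmul a a' ha' h1).symm

end Rigidity

end QuasiCocycle

namespace QuasiCocycle

open Monoid.CoprodI

/-! ### Finitely supported alternating families. -/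

section EssentialFamily

variable {𝕜 : Type*} [RCLike 𝕜] {ι : Type*} {G : ι → Type*} [∀ i, Group (G i)]
  {E : Type*} [NormedAddCommGroup E] [NormedSpace 𝕜 E] [DecidableEq ι]

/-- The alternating family supported on the factor `G i` obtained by antisymmetrizing the map
`s ↦ f s • e`. -/
noncomputable def alternatingFamily (ρ : Monoid.CoprodI G →* (E ≃ₗᵢ[𝕜] E)) (i : ι) (e : E) :
    (G i →₀ 𝕜) →ₗ[𝕜] (∀ j, G j → E) :=
  LinearMap.single 𝕜 (fun j => G j → E) i ∘ₗ
    { toFun := fun f s => f s • e - f s⁻¹ • ρ (of s) e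
      map_add' := fun f f' => by
        funext s
        simp only [Finsupp.add_apply, Pi.add_apply, add_smul]
        abel
      map_smul' := fun c f => by
        funext s
        simp only [Finsupp.smul_apply, Pi.smul_apply, smul_eq_mul, mul_smul, smul_sub,
          RingHom.id_apply] }

variable (ρ : Monoid.CoprodI G →* (E ≃ₗᵢ[𝕜] E)) (i : ι) (e : E) (f : G i →₀ 𝕜)

theorem alternatingFamily_same (s : G i) :
    alternatingFamily ρ i e f i s = f s • e - f s⁻¹ • ρ (of s) e := by
  simp [alternatingFamily]

theorem alternatingFamily_of_ne {j : ι} (h : j ≠ i) : alternatingFamily ρ i e f j = 0 := by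
  simp [alternatingFamily, h]

theorem isAlternating_alternatingFamily : IsAlternating ρ (alternatingFamily ρ i e f) := by
  intro j s
  by_cases h : j = i
  · subst h
    have hs : ρ (of s⁻¹) (ρ (of s) e) = e := by
      rw [← Function.comp_apply (f := ρ (of s⁻¹)), ← LinearIsometryEquiv.coe_mul, ← map_mul,
        ← map_mul]
      simp
    rw [alternatingFamily_same, alternatingFamily_same, inv_inv, map_sub, map_smul, map_smul, hs,
      neg_sub]
  · simp [alternatingFamily_of_ne ρ i e f h]

theorem finite_support_alternatingFamily :
    (Function.support (alternatingFamily ρ i e f i)).Finite := by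
  refine (f.hasFiniteSupport.union
    (f.hasFiniteSupport.preimage inv_injective.injOn)).subset fun s hs => ?_
  by_contra hns
  simp only [Set.mem_union, Set.mem_preimage, Function.mem_support, not_or, not_not] at hns
  exact hs (by rw [alternatingFamily_same, hns.1, hns.2, zero_smul, zero_smul, sub_zero])

theorem exists_norm_alternatingFamily_le :
    ∃ K : ℝ, ∀ j s, ‖alternatingFamily ρ i e f j s‖ ≤ K := by
  obtain ⟨M, hM⟩ : ∃ M : ℝ, ∀ s, ‖f s‖ ≤ M := by
    refine ⟨∑ s ∈ f.support, ‖f s‖, fun s => ?_⟩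
    by_cases hs : s ∈ f.support
    · exact Finset.single_le_sum (f := fun s => ‖f s‖) (fun _ _ => norm_nonneg _) hs
    · rw [Finsupp.notMem_support_iff.1 hs, norm_zero]
      exact Finset.sum_nonneg fun _ _ => norm_nonneg _
  have hM0 : 0 ≤ M := (norm_nonneg _).trans (hM 1)
  refine ⟨M * ‖e‖ + M * ‖e‖, fun j s => ?_⟩
  by_cases h : j = i
  · subst h
    rw [alternatingFamily_same]
    refine norm_sub_le_of_le ?_ ?_
    · rw [norm_smul]
      exact mul_le_mul_of_nonneg_right (hM _) (norm_nonneg _)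
    · rw [norm_smul, LinearIsometryEquiv.norm_map]
      exact mul_le_mul_of_nonneg_right (hM _) (norm_nonneg _)
  · rw [alternatingFamily_of_ne ρ i e f h, Pi.zero_apply, norm_zero]
    positivity

end EssentialFamily

/-! ### Pullback along group homomorphisms. -/

section Transport

variable {𝕜 : Type*} [RCLike 𝕜] {G H : Type*} [Group G] [Group H]
  {E : Type*} [NormedAddCommGroup E] [NormedSpace 𝕜 E]

theorem comp_mem_quasiCocycles {ρ : H →* (E ≃ₗᵢ[𝕜] E)} (φ : G →* H) {F : H → E}
    (hF : F ∈ quasiCocycles ρ) : F ∘ φ ∈ quasiCocycles (ρ.comp φ) := by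
  obtain ⟨C, hC⟩ := hF
  exact ⟨C, fun g g' => by simpa using hC (φ g) (φ g')⟩

theorem comp_mem_boundedFunctions_sup_cocycles {ρ : H →* (E ≃ₗᵢ[𝕜] E)} (φ : G →* H)
    {F : H → E} (hF : F ∈ boundedFunctions 𝕜 H E ⊔ cocycles ρ) :
    F ∘ φ ∈ boundedFunctions 𝕜 G E ⊔ cocycles (ρ.comp φ) := by
  obtain ⟨B, ⟨K, hK⟩, C, hC, rfl⟩ := Submodule.mem_sup.1 hF
  exact Submodule.mem_sup.2 ⟨B ∘ φ, ⟨K, fun g => hK _⟩, C ∘ φ,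
    fun g g' => by simpa using hC (φ g) (φ g'), rfl⟩

end Transport

/-! ### Quasi-cocycles and the comparison map. -/

section Comparison

variable {𝕜 : Type*} [RCLike 𝕜] {G : Type*} [Group G]
  {E : Type*} [NormedAddCommGroup E] [NormedSpace 𝕜 E] (ρ : G →* (E ≃ₗᵢ[𝕜] E))

theorem coboundary₁_eq_zero_iff {F : G → E} : coboundary₁ ρ F = 0 ↔ F ∈ cocycles ρ := by
  rw [funext_iff, Prod.forall]
  refine forall₂_congr fun g g' => ?_
  change ρ g (F g') - F (g * g') + F g = 0 ↔ F (g * g') = F g + ρ g (F g')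
  rw [sub_add_eq_add_sub, sub_eq_zero, eq_comm, add_comm]

theorem coboundary₁_mem_Z2b {F : G → E} (hF : F ∈ quasiCocycles ρ) : coboundary₁ ρ F ∈ Z2b ρ := by
  obtain ⟨C, hC⟩ := hF
  refine ⟨coboundary₂_coboundary₁ ρ F, C, fun p => ?_⟩
  rw [← norm_neg]
  refine le_of_eq_of_le (congrArg _ ?_) (hC p.1 p.2)
  change -(ρ p.1 (F p.2) - F (p.1 * p.2) + F p.1) = _
  abel

/-- The map from quasi-cocycles to second bounded cohomology induced by the coboundary. -/
def quasiCocyclesToH2b : quasiCocycles ρ →ₗ[𝕜] H2b ρ :=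
  Submodule.mkQ _ ∘ₗ (coboundary₁ ρ).restrict fun _ hF => coboundary₁_mem_Z2b ρ hF

theorem quasiCocyclesToH2b_mem_ker (F : quasiCocycles ρ) :
    quasiCocyclesToH2b ρ F ∈ LinearMap.ker (comparison ρ) := by
  refine (Submodule.Quotient.mk_eq_zero _).2 ?_
  exact ⟨F, rfl⟩

/-- If `F` has the same coboundary as a bounded `B`, then `F - B` is a cocycle. -/
theorem ker_quasiCocyclesToH2b_le : LinearMap.ker (quasiCocyclesToH2b ρ) ≤
    (boundedFunctions 𝕜 G E ⊔ cocycles ρ).submoduleOf (quasiCocycles ρ) := by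
  intro F hF
  obtain ⟨B, hB, hBF⟩ := (Submodule.Quotient.mk_eq_zero _).1 (LinearMap.mem_ker.1 hF)
  refine Submodule.mem_sup.2 ⟨B, hB, F - B, ?_, add_sub_cancel _ _⟩
  rw [← coboundary₁_eq_zero_iff, map_sub, sub_eq_zero]
  exact hBF.symm

/-- The space of essential quasi-cocycles embeds in the kernel of the comparison map. -/
theorem finiteDimensional_essentialQuasiCocycles
    [FiniteDimensional 𝕜 (LinearMap.ker (comparison ρ))] :
    FiniteDimensional 𝕜 (EssentialQuasiCocycles ρ) := by
  set δ : quasiCocycles ρ →ₗ[𝕜] LinearMap.ker (comparison ρ) :=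
    (quasiCocyclesToH2b ρ).codRestrict _ (quasiCocyclesToH2b_mem_ker ρ) with hδ
  have hker : LinearMap.ker δ ≤
      (boundedFunctions 𝕜 G E ⊔ cocycles ρ).submoduleOf (quasiCocycles ρ) := by
    rw [hδ, LinearMap.ker_codRestrict]
    exact ker_quasiCocyclesToH2b_le ρ
  have : FiniteDimensional 𝕜 (quasiCocycles ρ ⧸ LinearMap.ker δ) :=
    Module.Finite.equiv δ.quotKerEquivRange.symm
  exact Module.Finite.of_surjective (Submodule.factor hker) (Submodule.factor_surjective hker)

end Comparison

/-! ### The free group of rank two. -/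

section FreeGroup

variable {𝕜 : Type*} [RCLike 𝕜] {E : Type*} [NormedAddCommGroup E] [NormedSpace 𝕜 E]

theorem not_finiteDimensional_essentialQuasiCocycles [CompleteSpace E] [UniformConvexSpace E]
    [Nontrivial E] (ρ : FreeGroup (Fin 2) →* (E ≃ₗᵢ[𝕜] E)) :
    ¬ FiniteDimensional 𝕜 (EssentialQuasiCocycles ρ) := by
  intro hfd
  obtain ⟨e, he⟩ := exists_ne (0 : E)
  set φ : FreeGroup (Fin 2) ≃* Monoid.CoprodI fun _ : Fin 2 => FreeGroup Unit :=
    freeGroupEquivCoprodI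
  set ρ' := ρ.comp φ.symm.toMonoidHom with hρ'
  have hρ : ρ'.comp φ.toMonoidHom = ρ := by
    ext g : 1
    simp [hρ']
  set x : FreeGroup Unit := FreeGroup.of ()
  have hinf : ¬ IsOfFinOrder x := 
    not_isOfFinOrder_of_isMulTorsionFree (FreeGroup.of_ne_one ())
  have hinj : Function.Injective fun n : ℕ => x ^ (n + 1) := fun m n hmn => by
    simpa using injective_pow_iff_not_isOfFinOrder.2 hinf hmn
  have : Infinite (FreeGroup Unit) := Infinite.of_injective _ hinj
  -- Only positive powers of `x` are used: none is the inverse of another, so antisymmetrizing loses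
  -- no coefficient.
  set f : (ℕ →₀ 𝕜) →ₗ[𝕜] (FreeGroup Unit →₀ 𝕜) :=
    Finsupp.lmapDomain 𝕜 𝕜 (fun n : ℕ => x ^ (n + 1)) with hf
  set lam : (ℕ →₀ 𝕜) →ₗ[𝕜] (∀ _ : Fin 2, FreeGroup Unit → E) :=
    alternatingFamily ρ' 0 e ∘ₗ f with hlam
  have hlam_apply : ∀ c n, lam c 0 (x ^ (n + 1)) = c n • e := by
    intro c n
    have h0 : Finsupp.mapDomain (fun n : ℕ => x ^ (n + 1)) c (x ^ (n + 1))⁻¹ = 0 := by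
      refine Finsupp.mapDomain_of_notMem_range _ _ ?_
      rintro ⟨m, hm⟩
      refine hinf (isOfFinOrder_iff_pow_eq_one.2 ⟨m + 1 + (n + 1), by omega, ?_⟩)
      rw [pow_add, mul_eq_one_iff_eq_inv]
      exact hm
    rw [hlam, LinearMap.comp_apply, alternatingFamily_same, hf, Finsupp.lmapDomain_apply, h0,
      Finsupp.mapDomain_apply hinj, zero_smul, sub_zero]
  have halt : ∀ c, IsAlternating ρ' (lam c) := fun c => isAlternating_alternatingFamily _ _ _ _
  set L : (ℕ →₀ 𝕜) →ₗ[𝕜] quasiCocycles ρ :=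
    { toFun := fun c => ⟨syllableCochain ρ' (lam c) ∘ φ, by
        obtain ⟨K, hK⟩ := exists_norm_alternatingFamily_le ρ' 0 e (f c)
        have h := comp_mem_quasiCocycles φ.toMonoidHom
          (syllableCochain_mem_quasiCocycles (halt c) hK)
        rwa [hρ] at h⟩
      map_add' := fun c c' => by
        ext g
        simp only [map_add]
        exact syllableSum_add ρ' _ _ _
      map_smul' := fun r c => by
        ext g
        simp only [map_smul]
        exact syllableSum_smul ρ' _ _ _ }
  have hLinj : Function.Injective (Submodule.mkQ
      ((boundedFunctions 𝕜 (FreeGroup (Fin 2)) E ⊔ cocycles ρ).submoduleOf (quasiCocycles ρ)) ∘ₗ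
        L) := by
    rw [injective_iff_map_eq_zero]
    intro c hc
    have hmem : syllableCochain ρ' (lam c) ∘ φ ∈
        boundedFunctions 𝕜 (FreeGroup (Fin 2)) E ⊔ cocycles ρ :=
      (Submodule.Quotient.mk_eq_zero (x := L c) _).1 hc
    have hmem' := comp_mem_boundedFunctions_sup_cocycles φ.symm.toMonoidHom hmem
    have hcomp : (syllableCochain ρ' (lam c) ∘ φ) ∘ φ.symm.toMonoidHom =
        syllableCochain ρ' (lam c) := by
      funext g
      simp
    rw [hcomp] at hmem'
    have hzero := eq_zero_of_syllableCochain_mem (halt c) (i := 0) (j := 1) (by decide)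
      (alternatingFamily_of_ne ρ' 0 e (f c) one_ne_zero)
      (finite_support_alternatingFamily ρ' 0 e (f c))
      hmem'
    ext n
    have hn := hlam_apply c n
    rw [hzero, Pi.zero_apply, eq_comm, smul_eq_zero] at hn
    exact hn.resolve_right he
  have := Module.Finite.of_injective _ hLinj
  exact not_finite_iff_infinite.2 (inferInstanceAs (Infinite ℕ))
    (Module.Finite.finite_basis (Finsupp.basisSingleOne (R := 𝕜) (ι := ℕ)))

end FreeGroup

end QuasiCocycle

theorem theorem3 {𝕜 : Type*} [RCLike 𝕜] {E : Type*} [NormedAddCommGroup E] [NormedSpace 𝕜 E]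
    [CompleteSpace E] [UniformConvexSpace E] [Nontrivial E]
    (ρ : FreeGroup (Fin 2) →* (E ≃ₗᵢ[𝕜] E)) :
    ¬ FiniteDimensional 𝕜 (QuasiCocycle.EssentialQuasiCocycles ρ) ∧
    ¬ FiniteDimensional 𝕜 (LinearMap.ker (QuasiCocycle.comparison ρ)) :=
  ⟨QuasiCocycle.not_finiteDimensional_essentialQuasiCocycles ρ, fun _ =>
    QuasiCocycle.not_finiteDimensional_essentialQuasiCocycles ρ
      (QuasiCocycle.finiteDimensional_essentialQuasiCocycles ρ)⟩
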